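/- Let $n\ge 3$, and let $u\ne v$ be two of the nodes $1,\dots,n$. For a simple undirected graph $G$ on these nodes, with Laplacian $L=D-A$, let $L=U\Lambda U^\top$ be an eigendecomposition with $U$ orthogonal and $\Lambda=\operatorname{diag}(\lambda_1\le\dots\le\lambda_n)$. The full Laplacian tokenization is the matrix $X=\mathcal P_{\mathrm{Lap}}(G)\in\mathbb R^{n\times 2n}$ whose row for the node $w$ is $(U_{w1},\dots,U_{wn},\lambda_1,\dots,\lambda_n)$. Let $T$ be a one-layer transformer without residual connections, with $H$ heads of dimension $d_h$ and hidden dimension $m=Hd_h$. It has an input projection $W_{\mathrm{in}}\in\mathbb R^{2n\times m}$ with $\|W_{\mathrm{in}}\|_2\le 1$ (for instance the identity when $m=2n$), query-key matrices $W_{QK}^{1},\dots,W_{QK}^{H}\in\mathbb R^{m\times m}$, a value matrix $W_V=[W_V^1,\dots,W_V^H]\in\mathbb R^{m\times m}$ with blocks $W_V^h\in\mathbb R^{m\times d_h}$, and a decoder $\mathrm{MLP}:\mathbb R^{m}\times\mathbb R^m\to\mathbb R$ with Lipschitz constant $\mathrm{Lip}_{\mathrm{MLP}}$ for the Euclidean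 norm. With $Y=XW_{\mathrm{in}}$ and $P^h=\mathrm{softmax}(YW_{QK}^hY^\top)$ (row-wise), the representation $h_w$ of a node $w$ is the concatenation over $h$ of the vectors $\sum_{w'}P^h_{ww'}Y_{w'}W_V^h$, and the output of $T$ is $\hat A_{uv}=\mathrm{MLP}(h_u,h_v)$. Suppose that $T$ predicts the edge $(u,v)$ in graphs of maximum degree $d_{\max}$: for every graph on the $n$ nodes with maximum degree $d_{\max}$ and for every choice of the eigendecomposition above, $\hat A_{uv}=A_{uv}$. Then, for every such graph and its tokens $X$, \[ \mathrm{Lip}_{\mathrm{MLP}}\cdot\|W_V\|_2\,(1+\gamma)\ \ge\ d_{\max},\qquad \gamma=\|W_{QK}\|_2\,\|X\|_2^2, \] where $\|\cdot\|_2$ is the spectral norm and $\|W_{QK}\|_2=\max_h\|W_{QK}^h\|_2$. -/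

import Mathlib

/-!
Permuting the nodes permutes the rows of the tokens, so a transformer that predicts one pair of
nodes predicts every pair. In `laplacianTokens U lam = [U | 0] + [0 | lam]` the second summand has
equal rows: it shifts each row of logits by a constant, which softmax ignores. Hence all the
attention rows are close to uniform, all node representations are close to the average value vector,
and the outputs at an edge and at a non-edge of the same graph differ by at most
`Lip ‖WV‖ ‖Win‖³ ‖W_QK‖ √(2n(1 + ∑ λₖ²))`, although their difference is `1`. Since
`dmax² ≤ ∑ λₖ²`, while `‖X‖² ≥ 1 + n ∑ λₖ²`, the bound follows. If `G` is complete, an edge is first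
deleted without changing the maximum degree.
-/

open scoped NNReal Matrix.Norms.L2Operator

noncomputable section

/-- `U` and `lam` form an orthonormal eigendecomposition `U diag(lam) Uᵀ` of the Laplacian
`L = D - A` of `G`, the eigenvalues being listed in nondecreasing order. If an eigenvalue is
repeated (and up to signs in any case) several `U` qualify. -/
structure IsLaplacianDecomposition {n : ℕ} (G : SimpleGraph (Fin n)) [DecidableRel G.Adj]
    (U : Matrix (Fin n) (Fin n) ℝ) (lam : Fin n → ℝ) : Prop where
  orthogonal : U ∈ Matrix.orthogonalGroup (Fin n) ℝ
  sorted : Monotone lam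
  decomposition : G.lapMatrix ℝ = U * Matrix.diagonal lam * U.transpose

/-- The full Laplacian (spectral) token matrix in `ℝ^(n × 2n)`: the row of the node `v` is
`(u_1(v), …, u_n(v), lam_1, …, lam_n)`, where `u_k` is the `k`-th column of `U`. -/
def laplacianTokens {n : ℕ} (U : Matrix (Fin n) (Fin n) ℝ) (lam : Fin n → ℝ) :
    Matrix (Fin n) (Fin n ⊕ Fin n) ℝ :=
  Matrix.fromCols U (Matrix.of fun _ k => lam k)

/-- Row-wise softmax. -/
def rowSoftmax {n : ℕ} (S : Matrix (Fin n) (Fin n) ℝ) : Matrix (Fin n) (Fin n) ℝ :=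
  Matrix.of fun u w => Real.exp (S u w) / ∑ w', Real.exp (S u w')

/-- Parameters of a one-layer softmax transformer (no residual connection) on `n` tokens in
`ℝ^(2n)`, with `H` heads of dimension `dh`, hence hidden dimension `m = H * dh`:
* `Win` is the input projection;
* `WQK h` is the query-key matrix of the head `h`, the product of the query and the transposed key
  matrix, with the factor `1 / √dh` included;
* `WV` is the value matrix, the concatenation of the `m × dh` value matrices of the heads;
* `mlp` is the decoder, applied to the concatenation of two token representations. It may be any
  function; `WithLp 2` puts the Euclidean norm of `ℝ^(2m)` on its domain. -/
structure OneLayerTransformer (n H dh : ℕ) where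
  Win : Matrix (Fin n ⊕ Fin n) (Fin (H * dh)) ℝ
  WQK : Fin H → Matrix (Fin (H * dh)) (Fin (H * dh)) ℝ
  WV : Matrix (Fin (H * dh)) (Fin (H * dh)) ℝ
  mlp : WithLp 2 (EuclideanSpace ℝ (Fin (H * dh)) × EuclideanSpace ℝ (Fin (H * dh))) → ℝ

namespace OneLayerTransformer

variable {n H dh : ℕ} (T : OneLayerTransformer n H dh)

/-- Attention matrix of the head `h`: `softmax (Y WQK Yᵀ)` with `Y = X Win`. -/
def attention (X : Matrix (Fin n) (Fin n ⊕ Fin n) ℝ) (h : Fin H) : Matrix (Fin n) (Fin n) ℝ :=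
  rowSoftmax ((X * T.Win) * T.WQK h * (X * T.Win).transpose)

/-- Representation of the node `u` after the attention layer, the concatenation of the outputs
`∑ w, P_{uw} Y_w WV` of the heads. The coordinate `j` belongs to the head `j.divNat = j / dh`. -/
def hidden (X : Matrix (Fin n) (Fin n ⊕ Fin n) ℝ) (u : Fin n) :
    EuclideanSpace ℝ (Fin (H * dh)) :=
  WithLp.toLp 2 fun j => (T.attention X j.divNat * (X * T.Win * T.WV)) u j

/-- The output `MLP(h_u, h_v)` for the pair `(u, v)`. -/
def edgeOutput (X : Matrix (Fin n) (Fin n ⊕ Fin n) ℝ) (u v : Fin n) : ℝ :=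
  T.mlp (WithLp.toLp 2 (T.hidden X u, T.hidden X v))

/-- `T` predicts the edge `(u, v)` in the graphs on `n` nodes with maximum degree `d`: from the
Laplacian tokens of any such graph, whichever orthonormal eigenbasis they are computed from, it
outputs the adjacency entry `A_{uv}`. -/
def PredictsEdge (u v : Fin n) (d : ℕ) : Prop :=
  ∀ (G : SimpleGraph (Fin n)) [DecidableRel G.Adj], G.maxDegree = d →
    ∀ (U : Matrix (Fin n) (Fin n) ℝ) (lam : Fin n → ℝ), IsLaplacianDecomposition G U lam →
      T.edgeOutput (laplacianTokens U lam) u v = G.adjMatrix ℝ u v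

/-- Maximum logit energy `γ = ‖W_QK‖₂ ‖X‖₂²` (spectral norms), where `‖W_QK‖₂` is the largest norm
among the heads. -/
def logitEnergy (X : Matrix (Fin n) (Fin n ⊕ Fin n) ℝ) : ℝ :=
  (⨆ h, ‖T.WQK h‖) * ‖X‖ ^ 2

end OneLayerTransformer

end

section Matrices

open Matrix

section FiniteSums

variable {ι : Type*} [Fintype ι]

theorem sum_sum_sq_sub (a : ι → ℝ) :
    ∑ i, ∑ j, (a i - a j) ^ 2 =
      2 * Fintype.card ι * ∑ i, a i ^ 2 - 2 * (∑ i, a i) ^ 2 := by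
  simp only [sub_sq, Finset.sum_add_distrib, Finset.sum_sub_distrib, Finset.sum_const,
    Finset.card_univ, nsmul_eq_mul, ← Finset.mul_sum, ← Finset.sum_mul]
  ring

theorem sum_sub_average [Nonempty ι] (f : ι → ℝ) :
    ∑ i, (f i - (∑ j, f j) / Fintype.card ι) = 0 := by
  rw [Finset.sum_sub_distrib, Finset.sum_const, Finset.card_univ, nsmul_eq_mul,
    mul_div_cancel₀ _ (Nat.cast_ne_zero.2 Fintype.card_ne_zero), sub_self]

theorem sum_sq_sub_average_le_of_abs_sub_le [Nonempty ι] {f g : ι → ℝ} {K : ℝ}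
    (h : ∀ i j, |f i - f j| ≤ K * |g i - g j|) (c : ℝ) :
    ∑ i, (f i - (∑ j, f j) / Fintype.card ι) ^ 2 ≤ K ^ 2 * ∑ i, (g i - c) ^ 2 := by
  set μ := (∑ j, f j) / (Fintype.card ι : ℝ)
  have hpairs : ∑ i, ∑ j, (f i - μ - (f j - μ)) ^ 2 ≤
      K ^ 2 * ∑ i, ∑ j, (g i - c - (g j - c)) ^ 2 := by
    simp only [sub_sub_sub_cancel_right, Finset.mul_sum]
    gcongr with i _ j _
    rw [← sq_abs, ← sq_abs (g i - g j), ← mul_pow]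
    exact pow_le_pow_left₀ (abs_nonneg _) (h i j) 2
  rw [sum_sum_sq_sub, sum_sum_sq_sub, sum_sub_average] at hpairs
  have hcard : (0 : ℝ) < Fintype.card ι := Nat.cast_pos.2 Fintype.card_pos
  refine le_of_mul_le_mul_left ?_ hcard
  nlinarith [mul_nonneg (sq_nonneg K) (sq_nonneg (∑ i, (g i - c)))]

theorem sq_sum_mul_sub_average_le {p : ι → ℝ} (hp : ∑ i, p i = 1) (f : ι → ℝ) (c : ℝ) :
    (∑ i, p i * f i - (∑ i, f i) / Fintype.card ι) ^ 2 ≤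
      (∑ i, (p i - 1 / Fintype.card ι) ^ 2) * ∑ i, (f i - c) ^ 2 := by
  have : Nonempty ι := by
    by_contra hι
    simp [not_nonempty_iff.1 hι] at hp
  have hzero : ∑ i, (p i - 1 / Fintype.card ι) = 0 := hp ▸ sum_sub_average p
  have hsplit : ∑ i, p i * f i - (∑ i, f i) / Fintype.card ι =
      ∑ i, (p i - 1 / Fintype.card ι) * (f i - c) := by
    simp only [mul_sub, Finset.sum_sub_distrib _ fun i => (p i - _) * c, ← Finset.sum_mul, hzero,
      zero_mul, sub_zero]
    simp only [sub_mul, Finset.sum_sub_distrib, one_div_mul_eq_div, Finset.sum_div]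
  rw [hsplit]
  exact Finset.sum_mul_sq_le_sq_mul_sq _ _ _

end FiniteSums

section Softmax

theorem abs_sinh_le_abs_mul_cosh (x : ℝ) : |Real.sinh x| ≤ |x| * Real.cosh x := by
  have hderiv (y : ℝ) : HasDerivAt (fun y => y * Real.cosh y - Real.sinh y)
      (1 * Real.cosh y + y * Real.sinh y - Real.cosh y) y :=
    ((hasDerivAt_id y).mul (Real.hasDerivAt_cosh y)).sub (Real.hasDerivAt_sinh y)
  have hmono : Monotone fun y : ℝ => y * Real.cosh y - Real.sinh y := by
    refine monotone_of_hasDerivAt_nonneg hderiv fun y => ?_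
    have hy : 0 ≤ y * Real.sinh y := by
      rcases le_total 0 y with h | h
      · exact mul_nonneg h (Real.sinh_nonneg_iff.2 h)
      · exact mul_nonneg_of_nonpos_of_nonpos h (Real.sinh_nonpos_iff.2 h)
    simpa using hy
  have h := hmono (abs_nonneg x)
  simp only [zero_mul, Real.sinh_zero, sub_self, sub_nonneg] at h
  rwa [Real.abs_sinh, ← Real.cosh_abs x]

theorem abs_exp_sub_exp_le (a b : ℝ) :
    |Real.exp a - Real.exp b| ≤ |a - b| * ((Real.exp a + Real.exp b) / 2) := by
  have ha : Real.exp a = Real.exp ((a + b) / 2) * Real.exp ((a - b) / 2) := by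
    rw [← Real.exp_add]; ring_nf
  have hb : Real.exp b = Real.exp ((a + b) / 2) * Real.exp (-((a - b) / 2)) := by
    rw [← Real.exp_add]; ring_nf
  have hsub : Real.exp a - Real.exp b =
      Real.exp ((a + b) / 2) * (2 * Real.sinh ((a - b) / 2)) := by
    rw [ha, hb, Real.sinh_eq]; ring
  have hadd : Real.exp a + Real.exp b =
      Real.exp ((a + b) / 2) * (2 * Real.cosh ((a - b) / 2)) := by
    rw [ha, hb, Real.cosh_eq]; ring
  rw [hsub, hadd, abs_mul, abs_mul, Real.abs_exp, abs_two]
  calc Real.exp ((a + b) / 2) * (2 * |Real.sinh ((a - b) / 2)|)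
      ≤ Real.exp ((a + b) / 2) * (2 * (|(a - b) / 2| * Real.cosh ((a - b) / 2))) := by
        gcongr
        exact abs_sinh_le_abs_mul_cosh _
    _ = |a - b| * (Real.exp ((a + b) / 2) * (2 * Real.cosh ((a - b) / 2)) / 2) := by
        rw [abs_div, abs_two]; ring

variable {n : ℕ} (S : Matrix (Fin n) (Fin n) ℝ)

theorem rowSoftmax_nonneg (u w : Fin n) : 0 ≤ rowSoftmax S u w := by
  simp only [rowSoftmax, of_apply]
  positivity

theorem sum_rowSoftmax (u : Fin n) : ∑ w, rowSoftmax S u w = 1 := by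
  simp only [rowSoftmax, of_apply, ← Finset.sum_div]
  exact div_self (Finset.sum_pos (fun w _ => Real.exp_pos (S u w)) ⟨u, Finset.mem_univ u⟩).ne'

theorem rowSoftmax_submatrix (σ τ : Equiv.Perm (Fin n)) :
    rowSoftmax (S.submatrix σ τ) = (rowSoftmax S).submatrix σ τ := by
  ext u w
  simp only [rowSoftmax, of_apply, submatrix_apply, Equiv.sum_comp τ fun w => Real.exp (S (σ u) w)]

theorem abs_rowSoftmax_sub_le (u i j : Fin n) :
    |rowSoftmax S u i - rowSoftmax S u j| ≤ 1 / 2 * |S u i - S u j| := by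
  rcases eq_or_ne i j with rfl | hij
  · simp
  have hsum : rowSoftmax S u i + rowSoftmax S u j ≤ 1 := by
    rw [← sum_rowSoftmax S u, ← Finset.sum_pair hij]
    exact Finset.sum_le_sum_of_subset_of_nonneg (Finset.subset_univ _)
      fun w _ _ => rowSoftmax_nonneg S u w
  calc |rowSoftmax S u i - rowSoftmax S u j|
      = |Real.exp (S u i) - Real.exp (S u j)| / ∑ w, Real.exp (S u w) := by
        simp only [rowSoftmax, of_apply]
        rw [← sub_div, abs_div, abs_of_nonneg (Finset.sum_nonneg fun w _ => Real.exp_nonneg _)]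
    _ ≤ |S u i - S u j| * ((Real.exp (S u i) + Real.exp (S u j)) / 2) /
          ∑ w, Real.exp (S u w) := by
        gcongr
        exact abs_exp_sub_exp_le _ _
    _ = |S u i - S u j| * ((rowSoftmax S u i + rowSoftmax S u j) / 2) := by
        simp only [rowSoftmax, of_apply]
        ring
    _ ≤ |S u i - S u j| * (1 / 2) := by gcongr
    _ = 1 / 2 * |S u i - S u j| := mul_comm _ _

theorem sum_sq_rowSoftmax_sub_inv_card_le (u : Fin n) (c : ℝ) :
    ∑ w, (rowSoftmax S u w - 1 / n) ^ 2 ≤ (∑ w, (S u w - c) ^ 2) / 4 := by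
  have : Nonempty (Fin n) := ⟨u⟩
  have h := sum_sq_sub_average_le_of_abs_sub_le (abs_rowSoftmax_sub_le S u) c
  rw [sum_rowSoftmax, Fintype.card_fin] at h
  linarith

end Softmax

section SpectralNorm

variable {m n : Type*} [Fintype m] [Fintype n]

theorem sum_sq_vecMul_of_mul_transpose_eq_one [DecidableEq m] {A : Matrix m n ℝ}
    (hA : A * Aᵀ = 1) (x : m → ℝ) :
    ∑ j, (x ᵥ* A) j ^ 2 = ∑ i, x i ^ 2 := by
  have h : x ᵥ* A ⬝ᵥ x ᵥ* A = x ⬝ᵥ x := by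
    rw [← mulVec_transpose A x, dotProduct_mulVec, mulVec_transpose, vecMul_vecMul, hA, vecMul_one]
  simpa only [dotProduct, ← sq] using h

variable [DecidableEq n]

theorem sum_sq_mulVec_le (A : Matrix m n ℝ) (x : n → ℝ) :
    ∑ i, (A *ᵥ x) i ^ 2 ≤ ‖A‖ ^ 2 * ∑ j, x j ^ 2 := by
  have h := pow_le_pow_left₀ (norm_nonneg _) (l2_opNorm_mulVec A (WithLp.toLp 2 x)) 2
  rwa [mul_pow, EuclideanSpace.real_norm_sq_eq, EuclideanSpace.real_norm_sq_eq] at h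

theorem sum_sq_vecMul_le (A : Matrix m n ℝ) (x : m → ℝ) :
    ∑ j, (x ᵥ* A) j ^ 2 ≤ ‖A‖ ^ 2 * ∑ i, x i ^ 2 := by
  classical
  rw [← l2_opNorm_conjTranspose, conjTranspose_eq_transpose_of_trivial, ← mulVec_transpose]
  exact sum_sq_mulVec_le Aᵀ x

theorem sum_sq_row_le (A : Matrix m n ℝ) (i : m) : ∑ j, A i j ^ 2 ≤ ‖A‖ ^ 2 := by
  classical
  simpa [Pi.single_apply] using sum_sq_vecMul_le A (Pi.single i 1)

theorem sum_sum_sq_le (A : Matrix m n ℝ) : ∑ i, ∑ j, A i j ^ 2 ≤ Fintype.card m * ‖A‖ ^ 2 := by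
  refine (Finset.sum_le_sum fun i _ => sum_sq_row_le A i).trans ?_
  simp

theorem l2_opNorm_le_one_of_mul_transpose_eq_one [DecidableEq m] {A : Matrix m n ℝ}
    (hA : A * Aᵀ = 1) :
    ‖A‖ ≤ 1 := by
  have hsq : ‖A‖ * ‖A‖ = ‖(1 : Matrix m m ℝ)‖ := by
    rw [← hA, ← l2_opNorm_conjTranspose A, ← l2_opNorm_conjTranspose_mul_self,
      conjTranspose_conjTranspose, conjTranspose_eq_transpose_of_trivial]
  have hone : ‖(1 : Matrix m m ℝ)‖ ≤ 1 := by
    rw [← diagonal_one, l2_opNorm_diagonal]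
    exact (pi_norm_const_le (1 : ℝ)).trans_eq norm_one
  nlinarith [norm_nonneg A]

end SpectralNorm

section Attention

variable {n : ℕ} {m : Type*} [Fintype m] [DecidableEq m] {Y Z : Matrix (Fin n) m ℝ} {c : m → ℝ}

theorem sum_sq_rowSoftmax_mul_mul_transpose_sub_inv_card_le (hY : Y = Z + replicateRow (Fin n) c)
    (W : Matrix m m ℝ) (u : Fin n) :
    ∑ w, (rowSoftmax (Y * W * Yᵀ) u w - 1 / n) ^ 2 ≤
      ‖Z‖ ^ 2 * (‖W‖ ^ 2 * ∑ k, Y u k ^ 2) / 4 := by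
  set r : m → ℝ := Y u ᵥ* W
  have hlogit (w : Fin n) : (Y * W * Yᵀ) u w - r ⬝ᵥ c = (Z *ᵥ r) w := by
    calc (Y * W * Yᵀ) u w - r ⬝ᵥ c = r ⬝ᵥ (Z w + c) - r ⬝ᵥ c := by subst hY; rfl
      _ = Z w ⬝ᵥ r := by rw [dotProduct_add, add_sub_cancel_right, dotProduct_comm]
  calc ∑ w, (rowSoftmax (Y * W * Yᵀ) u w - 1 / n) ^ 2
      ≤ (∑ w, (Z *ᵥ r) w ^ 2) / 4 := by
        simpa only [hlogit] using sum_sq_rowSoftmax_sub_inv_card_le (Y * W * Yᵀ) u (r ⬝ᵥ c)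
    _ ≤ ‖Z‖ ^ 2 * (∑ k, r k ^ 2) / 4 := by
        gcongr
        exact sum_sq_mulVec_le Z r
    _ ≤ ‖Z‖ ^ 2 * (‖W‖ ^ 2 * ∑ k, Y u k ^ 2) / 4 := by
        gcongr
        exact sum_sq_vecMul_le W (Y u)

end Attention

section Tokens

variable {n : ℕ} {U : Matrix (Fin n) (Fin n) ℝ} (lam : Fin n → ℝ)

theorem laplacianTokens_eq_fromCols_add_replicateRow :
    laplacianTokens U lam = fromCols U 0 + replicateRow (Fin n) (Sum.elim 0 lam) := by
  ext i (k | k) <;> simp [laplacianTokens]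

theorem laplacianTokens_submatrix (σ : Equiv.Perm (Fin n)) :
    laplacianTokens (U.submatrix σ id) lam = (laplacianTokens U lam).submatrix σ id := by
  ext i (k | k) <;> rfl

theorem l2_opNorm_fromCols_zero_le_one (hU : U * Uᵀ = 1) :
    ‖fromCols U (0 : Matrix (Fin n) (Fin n) ℝ)‖ ≤ 1 := by
  refine l2_opNorm_le_one_of_mul_transpose_eq_one ?_
  rw [transpose_fromCols, fromCols_mul_fromRows, hU, Matrix.zero_mul, add_zero]

theorem sum_sq_vecMul_laplacianTokens (hU : U * Uᵀ = 1) (x : Fin n → ℝ) :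
    ∑ k, (x ᵥ* laplacianTokens U lam) k ^ 2 =
      ∑ i, x i ^ 2 + (∑ i, x i) ^ 2 * ∑ k, lam k ^ 2 := by
  rw [← sum_sq_vecMul_of_mul_transpose_eq_one hU, Fintype.sum_sum_type]
  congr 1
  simp [laplacianTokens, vecMul, dotProduct, ← Finset.sum_mul, mul_pow, Finset.mul_sum]

theorem sum_sq_laplacianTokens_row (hU : U * Uᵀ = 1) (u : Fin n) :
    ∑ k, laplacianTokens U lam u k ^ 2 = 1 + ∑ k, lam k ^ 2 := by
  simpa [Pi.single_apply] using sum_sq_vecMul_laplacianTokens lam hU (Pi.single u 1)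

theorem one_add_mul_sum_sq_le_sq_norm_laplacianTokens [NeZero n] (hU : U * Uᵀ = 1) :
    1 + n * ∑ k, lam k ^ 2 ≤ ‖laplacianTokens U lam‖ ^ 2 := by
  have hn : (0 : ℝ) < n := Nat.cast_pos.2 (NeZero.pos n)
  have h := sum_sq_vecMul_le (laplacianTokens U lam) 1
  rw [sum_sq_vecMul_laplacianTokens lam hU] at h
  simp only [Pi.one_apply, one_pow, Finset.sum_const, Finset.card_univ, Fintype.card_fin,
    nsmul_eq_mul, mul_one] at h
  refine le_of_mul_le_mul_right ?_ hn
  linarith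

end Tokens

namespace OneLayerTransformer

variable {n H dh : ℕ} (T : OneLayerTransformer n H dh)

/-- The average of the value vectors of all tokens: the representation that every node would get
under uniform attention. -/
noncomputable def meanValue (X : Matrix (Fin n) (Fin n ⊕ Fin n) ℝ) :
    EuclideanSpace ℝ (Fin (H * dh)) :=
  WithLp.toLp 2 fun j => (∑ w, (X * T.Win * T.WV) w j) / n

section Equivariance

variable (X : Matrix (Fin n) (Fin n ⊕ Fin n) ℝ) (σ : Equiv.Perm (Fin n))

theorem attention_submatrix (h : Fin H) :
    T.attention (X.submatrix σ id) h = (T.attention X h).submatrix σ σ :=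
  rowSoftmax_submatrix (X * T.Win * T.WQK h * (X * T.Win)ᵀ) σ σ

theorem hidden_submatrix (u : Fin n) : T.hidden (X.submatrix σ id) u = T.hidden X (σ u) := by
  ext j
  simp only [hidden, attention_submatrix]
  exact Equiv.sum_comp σ fun w => T.attention X j.divNat (σ u) w * (X * T.Win * T.WV) w j

theorem edgeOutput_submatrix (u v : Fin n) :
    T.edgeOutput (X.submatrix σ id) u v = T.edgeOutput X (σ u) (σ v) := by
  simp only [edgeOutput, hidden_submatrix]

end Equivariance

theorem norm_WQK_le_iSup (h : Fin H) : ‖T.WQK h‖ ≤ ⨆ h, ‖T.WQK h‖ :=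
  le_ciSup (f := fun h => ‖T.WQK h‖) (Set.finite_range _).bddAbove h

theorem iSup_norm_WQK_nonneg : 0 ≤ ⨆ h, ‖T.WQK h‖ :=
  Real.iSup_nonneg fun _ => norm_nonneg _

theorem logitEnergy_nonneg (X : Matrix (Fin n) (Fin n ⊕ Fin n) ℝ) : 0 ≤ T.logitEnergy X :=
  mul_nonneg T.iSup_norm_WQK_nonneg (sq_nonneg _)

section Deviation

variable {X Z : Matrix (Fin n) (Fin n ⊕ Fin n) ℝ} {c : Fin n ⊕ Fin n → ℝ}

theorem sum_sq_attention_sub_inv_card_le (hX : X = Z + replicateRow (Fin n) c) (h : Fin H)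
    (u : Fin n) :
    ∑ w, (T.attention X h u w - 1 / n) ^ 2 ≤
      (‖Z‖ * ‖T.Win‖ ^ 2 * ⨆ h, ‖T.WQK h‖) ^ 2 * (∑ k, X u k ^ 2) / 4 := by
  have hY : X * T.Win = Z * T.Win + replicateRow (Fin n) (c ᵥ* T.Win) := by
    rw [hX, Matrix.add_mul, replicateRow_vecMul]
  calc ∑ w, (T.attention X h u w - 1 / n) ^ 2
      ≤ ‖Z * T.Win‖ ^ 2 * (‖T.WQK h‖ ^ 2 * ∑ k, (X * T.Win) u k ^ 2) / 4 :=
        sum_sq_rowSoftmax_mul_mul_transpose_sub_inv_card_le hY (T.WQK h) u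
    _ ≤ (‖Z‖ * ‖T.Win‖) ^ 2 * ((⨆ h, ‖T.WQK h‖) ^ 2 * (‖T.Win‖ ^ 2 * ∑ k, X u k ^ 2)) / 4 := by
        gcongr
        · exact l2_opNorm_mul _ _
        · exact T.norm_WQK_le_iSup h
        · exact sum_sq_vecMul_le T.Win (X u)
    _ = (‖Z‖ * ‖T.Win‖ ^ 2 * ⨆ h, ‖T.WQK h‖) ^ 2 * (∑ k, X u k ^ 2) / 4 := by ring

theorem sq_hidden_sub_meanValue_le (hX : X = Z + replicateRow (Fin n) c) (u : Fin n)
    (j : Fin (H * dh)) :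
    (T.hidden X u j - T.meanValue X j) ^ 2 ≤
      (‖Z‖ * ‖T.Win‖ ^ 2 * ⨆ h, ‖T.WQK h‖) ^ 2 * (∑ k, X u k ^ 2) / 4 *
        ∑ w, (Z * T.Win * T.WV) w j ^ 2 := by
  have hvalue (w : Fin n) :
      (X * T.Win * T.WV) w j - (c ᵥ* T.Win ᵥ* T.WV) j = (Z * T.Win * T.WV) w j := by
    rw [hX, Matrix.add_mul, Matrix.add_mul, ← replicateRow_vecMul, ← replicateRow_vecMul]
    exact add_sub_cancel_right _ _
  have hsum : ∑ w, T.attention X j.divNat u w = 1 := sum_rowSoftmax _ u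
  have h := sq_sum_mul_sub_average_le hsum (fun w => (X * T.Win * T.WV) w j)
    ((c ᵥ* T.Win ᵥ* T.WV) j)
  simp only [hvalue, Fintype.card_fin] at h
  exact h.trans (by gcongr; exact T.sum_sq_attention_sub_inv_card_le hX _ u)

theorem sq_norm_hidden_sub_meanValue_le (hX : X = Z + replicateRow (Fin n) c) (u : Fin n) :
    ‖T.hidden X u - T.meanValue X‖ ^ 2 ≤
      (‖Z‖ ^ 2 * ‖T.Win‖ ^ 3 * (⨆ h, ‖T.WQK h‖) * ‖T.WV‖) ^ 2 * (n * ∑ k, X u k ^ 2) / 4 := by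
  set K := (‖Z‖ * ‖T.Win‖ ^ 2 * ⨆ h, ‖T.WQK h‖) ^ 2 * (∑ k, X u k ^ 2) / 4 with hK
  have hnorm : ‖Z * T.Win * T.WV‖ ≤ ‖Z‖ * ‖T.Win‖ * ‖T.WV‖ :=
    (l2_opNorm_mul _ _).trans (by gcongr; exact l2_opNorm_mul _ _)
  calc ‖T.hidden X u - T.meanValue X‖ ^ 2
      = ∑ j, (T.hidden X u j - T.meanValue X j) ^ 2 := EuclideanSpace.real_norm_sq_eq _
    _ ≤ ∑ j, K * ∑ w, (Z * T.Win * T.WV) w j ^ 2 :=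
        Finset.sum_le_sum fun j _ => T.sq_hidden_sub_meanValue_le hX u j
    _ = K * ∑ w, ∑ j, (Z * T.Win * T.WV) w j ^ 2 := by rw [← Finset.mul_sum, Finset.sum_comm]
    _ ≤ K * (n * ‖Z * T.Win * T.WV‖ ^ 2) := by
        gcongr
        simpa only [Fintype.card_fin] using sum_sum_sq_le (Z * T.Win * T.WV)
    _ ≤ K * (n * (‖Z‖ * ‖T.Win‖ * ‖T.WV‖) ^ 2) := by gcongr
    _ = (‖Z‖ ^ 2 * ‖T.Win‖ ^ 3 * (⨆ h, ‖T.WQK h‖) * ‖T.WV‖) ^ 2 * (n * ∑ k, X u k ^ 2) / 4 := by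
        rw [hK]; ring

end Deviation

section LaplacianTokens

variable {U : Matrix (Fin n) (Fin n) ℝ}

theorem norm_hidden_laplacianTokens_sub_meanValue_le (hU : U * Uᵀ = 1) (lam : Fin n → ℝ)
    (u : Fin n) :
    ‖T.hidden (laplacianTokens U lam) u - T.meanValue (laplacianTokens U lam)‖ ≤
      ‖T.WV‖ * ‖T.Win‖ ^ 3 * (⨆ h, ‖T.WQK h‖) * √(n * (1 + ∑ k, lam k ^ 2)) / 2 := by
  have hκ := T.iSup_norm_WQK_nonneg
  have h := T.sq_norm_hidden_sub_meanValue_le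
    (laplacianTokens_eq_fromCols_add_replicateRow (U := U) lam) u
  rw [sum_sq_laplacianTokens_row lam hU] at h
  refine le_of_sq_le_sq (h.trans ?_) (by positivity)
  calc _ ≤ (1 ^ 2 * ‖T.Win‖ ^ 3 * (⨆ h, ‖T.WQK h‖) * ‖T.WV‖) ^ 2 *
          (n * (1 + ∑ k, lam k ^ 2)) / 4 := by
        gcongr
        exact l2_opNorm_fromCols_zero_le_one hU
    _ = _ := by
        rw [div_pow, mul_pow _ √_, Real.sq_sqrt (by positivity)]
        ring

theorem norm_hidden_laplacianTokens_sub_hidden_le (hU : U * Uᵀ = 1) (lam : Fin n → ℝ)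
    (a b : Fin n) :
    ‖T.hidden (laplacianTokens U lam) a - T.hidden (laplacianTokens U lam) b‖ ≤
      ‖T.WV‖ * ‖T.Win‖ ^ 3 * (⨆ h, ‖T.WQK h‖) * √(n * (1 + ∑ k, lam k ^ 2)) := by
  have ha := T.norm_hidden_laplacianTokens_sub_meanValue_le hU lam a
  have hb := T.norm_hidden_laplacianTokens_sub_meanValue_le hU lam b
  rw [← dist_eq_norm] at ha hb ⊢
  exact (dist_triangle_right _ _ _).trans (by linarith)

theorem abs_edgeOutput_laplacianTokens_sub_le (hU : U * Uᵀ = 1) (lam : Fin n → ℝ) {LipMLP : ℝ≥0}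
    (hLip : LipschitzWith LipMLP T.mlp) (a b c d : Fin n) :
    |T.edgeOutput (laplacianTokens U lam) a b - T.edgeOutput (laplacianTokens U lam) c d| ≤
      LipMLP * ‖T.WV‖ * ‖T.Win‖ ^ 3 * (⨆ h, ‖T.WQK h‖) * √(2 * n * (1 + ∑ k, lam k ^ 2)) := by
  set h := T.hidden (laplacianTokens U lam)
  set B := ‖T.WV‖ * ‖T.Win‖ ^ 3 * (⨆ h, ‖T.WQK h‖) * √(n * (1 + ∑ k, lam k ^ 2)) with hB
  have hhidden (i j : Fin n) : ‖h i - h j‖ ≤ B :=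
    T.norm_hidden_laplacianTokens_sub_hidden_le hU lam i j
  have hpair : ‖WithLp.toLp 2 (h a, h b) - WithLp.toLp 2 (h c, h d)‖ ≤ √2 * B := by
    rw [WithLp.prod_norm_eq_of_L2]
    refine Real.sqrt_le_iff.2 ⟨?_, ?_⟩
    · exact mul_nonneg (Real.sqrt_nonneg 2) ((norm_nonneg _).trans (hhidden a c))
    · have hac := pow_le_pow_left₀ (norm_nonneg _) (hhidden a c) 2
      have hbd := pow_le_pow_left₀ (norm_nonneg _) (hhidden b d) 2
      rw [mul_pow, Real.sq_sqrt zero_le_two, two_mul]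
      exact add_le_add hac hbd
  calc |T.edgeOutput (laplacianTokens U lam) a b - T.edgeOutput (laplacianTokens U lam) c d|
      ≤ LipMLP * ‖WithLp.toLp 2 (h a, h b) - WithLp.toLp 2 (h c, h d)‖ := by
        have hdist := hLip.dist_le_mul (WithLp.toLp 2 (h a, h b)) (WithLp.toLp 2 (h c, h d))
        rwa [Real.dist_eq, dist_eq_norm] at hdist
    _ ≤ LipMLP * (√2 * B) := by gcongr
    _ = LipMLP * ‖T.WV‖ * ‖T.Win‖ ^ 3 * (⨆ h, ‖T.WQK h‖) *
          √(2 * n * (1 + ∑ k, lam k ^ 2)) := by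
        rw [hB, mul_assoc (2 : ℝ), Real.sqrt_mul zero_le_two]
        ring

end LaplacianTokens

end OneLayerTransformer

theorem sum_sq_mul_diagonal_mul_transpose {n : Type*} [Fintype n] [DecidableEq n]
    {U : Matrix n n ℝ} (hU : U ∈ orthogonalGroup n ℝ) (d : n → ℝ) :
    ∑ i, ∑ j, (U * diagonal d * Uᵀ) i j ^ 2 = ∑ k, d k ^ 2 := by
  have hUU : Uᵀ * U = 1 := (mem_orthogonalGroup_iff' _ _).1 hU
  set A := U * diagonal d * Uᵀ with hA
  calc ∑ i, ∑ j, A i j ^ 2 = (A * Aᵀ).trace := by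
        simp only [trace, diag, mul_apply, transpose_apply, sq]
    _ = (Uᵀ * U * (diagonal d * (Uᵀ * U) * diagonal d)).trace := by
        rw [hA, transpose_mul, transpose_mul, transpose_transpose, diagonal_transpose,
          Matrix.mul_assoc Uᵀ, Matrix.trace_mul_comm Uᵀ]
        simp only [Matrix.mul_assoc]
    _ = ∑ k, d k ^ 2 := by
        rw [hUU, Matrix.one_mul, Matrix.mul_one, diagonal_mul_diagonal, trace_diagonal]
        simp only [sq]

section Laplacian

variable {V : Type*} [Fintype V] [DecidableEq V] (G : SimpleGraph V) [DecidableRel G.Adj]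

theorem lapMatrix_apply_self (v : V) : G.lapMatrix ℝ v v = G.degree v := by
  simp [SimpleGraph.lapMatrix, SimpleGraph.degMatrix]

theorem lapMatrix_apply_of_ne {v w : V} (h : v ≠ w) :
    G.lapMatrix ℝ v w = -G.adjMatrix ℝ v w := by
  simp [SimpleGraph.lapMatrix, SimpleGraph.degMatrix, h]

theorem lapMatrix_comap_perm (σ : Equiv.Perm V) [DecidableRel (G.comap σ).Adj] :
    (G.comap σ).lapMatrix ℝ = (G.lapMatrix ℝ).submatrix σ σ := by
  ext v w
  rcases eq_or_ne v w with rfl | h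
  · rw [submatrix_apply, lapMatrix_apply_self, lapMatrix_apply_self]
    exact congrArg Nat.cast ((SimpleGraph.Iso.comap σ G).degree_eq v).symm
  · rw [submatrix_apply, lapMatrix_apply_of_ne _ h, lapMatrix_apply_of_ne _ (σ.injective.ne h)]
    simp [SimpleGraph.adjMatrix_apply]

theorem sq_maxDegree_le_sum_sq_lapMatrix :
    (G.maxDegree : ℝ) ^ 2 ≤ ∑ v, ∑ w, G.lapMatrix ℝ v w ^ 2 := by
  rcases isEmpty_or_nonempty V with h | h
  · simp
  obtain ⟨v, hv⟩ := G.exists_maximal_degree_vertex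
  calc (G.maxDegree : ℝ) ^ 2 = G.lapMatrix ℝ v v ^ 2 := by rw [lapMatrix_apply_self, hv]
    _ ≤ ∑ w, G.lapMatrix ℝ v w ^ 2 :=
        Finset.single_le_sum (f := fun w => G.lapMatrix ℝ v w ^ 2) (fun _ _ => sq_nonneg _)
          (Finset.mem_univ v)
    _ ≤ ∑ v, ∑ w, G.lapMatrix ℝ v w ^ 2 :=
        Finset.single_le_sum (f := fun v => ∑ w, G.lapMatrix ℝ v w ^ 2)
          (fun _ _ => Finset.sum_nonneg fun _ _ => sq_nonneg _) (Finset.mem_univ v)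

variable {G} in
theorem sum_sq_lapMatrix_mono {G' : SimpleGraph V} [DecidableRel G'.Adj] (hle : G' ≤ G) :
    ∑ v, ∑ w, G'.lapMatrix ℝ v w ^ 2 ≤ ∑ v, ∑ w, G.lapMatrix ℝ v w ^ 2 := by
  gcongr ∑ v, ∑ w, ?_ with v _ w _
  rcases eq_or_ne v w with rfl | h
  · rw [lapMatrix_apply_self, lapMatrix_apply_self]
    gcongr
    exact SimpleGraph.degree_le_of_le hle
  · rw [lapMatrix_apply_of_ne _ h, lapMatrix_apply_of_ne _ h, neg_sq, neg_sq,
      SimpleGraph.adjMatrix_apply, SimpleGraph.adjMatrix_apply]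
    gcongr
    split_ifs with h₁ h₂
    exacts [le_rfl, absurd (hle h₁) h₂, zero_le_one, le_rfl]

end Laplacian

theorem exists_le_maxDegree_eq_ne_top {V : Type*} [Fintype V] (G : SimpleGraph V)
    [DecidableRel G.Adj] (hV : 3 ≤ Fintype.card V) :
    ∃ (G' : SimpleGraph V) (_ : DecidableRel G'.Adj),
      G' ≤ G ∧ G'.maxDegree = G.maxDegree ∧ G' ≠ ⊤ := by
  classical
  by_cases hG : G = ⊤
  swap
  · exact ⟨G, inferInstance, le_rfl, rfl, hG⟩
  obtain ⟨x, y, z, hxy, hxz, hyz⟩ := Fintype.two_lt_card_iff.1 hV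
  have : Nonempty V := ⟨x⟩
  have hle : G.deleteEdges {s(x, y)} ≤ G := SimpleGraph.deleteEdges_le _
  have huniv : (G.deleteEdges {s(x, y)}).IsUniversal z := fun w hw => by
    rw [SimpleGraph.deleteEdges_adj]
    exact ⟨hG ▸ hw, by simp [hxz.symm, hyz.symm]⟩
  refine ⟨G.deleteEdges {s(x, y)}, inferInstance, hle, (SimpleGraph.maxDegree_mono hle).antisymm ?_,
    SimpleGraph.ne_top_iff_exists_not_adj.2 ⟨x, y, hxy, by simp⟩⟩
  calc G.maxDegree ≤ Fintype.card V - 1 := Nat.le_sub_one_of_lt G.maxDegree_lt_card_verts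
    _ = (G.deleteEdges {s(x, y)}).degree z :=
        ((SimpleGraph.degree_eq_card_sub_one _ z).2 huniv).symm
    _ ≤ (G.deleteEdges {s(x, y)}).maxDegree := SimpleGraph.degree_le_maxDegree _ z

section Decomposition

variable {n : ℕ}

theorem exists_isLaplacianDecomposition (G : SimpleGraph (Fin n)) [DecidableRel G.Adj] :
    ∃ U lam, IsLaplacianDecomposition G U lam := by
  have hL := G.isHermitian_lapMatrix ℝ
  set V : Matrix (Fin n) (Fin n) ℝ := hL.eigenvectorUnitary.1
  have hV : V * Vᵀ = 1 := (mem_orthogonalGroup_iff _ _).1 hL.eigenvectorUnitary.2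
  have hspec : G.lapMatrix ℝ = V * diagonal hL.eigenvalues * Vᵀ := by
    conv_lhs => rw [hL.spectral_theorem, Unitary.conjStarAlgAut_apply]
    rfl
  set σ := Tuple.sort hL.eigenvalues
  refine ⟨V.submatrix id σ, hL.eigenvalues ∘ σ, ?_, Tuple.monotone_sort _, ?_⟩
  · rw [mem_orthogonalGroup_iff, transpose_submatrix, submatrix_mul_equiv, hV, submatrix_id_id]
  · refine hspec.trans ?_
    rw [← submatrix_diagonal_equiv, transpose_submatrix, submatrix_mul_equiv,
      submatrix_mul_equiv, submatrix_id_id]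

variable {G : SimpleGraph (Fin n)} [DecidableRel G.Adj] {U : Matrix (Fin n) (Fin n) ℝ}
  {lam : Fin n → ℝ}

namespace IsLaplacianDecomposition

theorem mul_transpose (h : IsLaplacianDecomposition G U lam) : U * Uᵀ = 1 :=
  (mem_orthogonalGroup_iff _ _).1 h.orthogonal

theorem sum_sq_eigenvalues (h : IsLaplacianDecomposition G U lam) :
    ∑ k, lam k ^ 2 = ∑ i, ∑ j, G.lapMatrix ℝ i j ^ 2 := by
  rw [h.decomposition, sum_sq_mul_diagonal_mul_transpose h.orthogonal]

theorem comap_perm (h : IsLaplacianDecomposition G U lam) (σ : Equiv.Perm (Fin n))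
    [DecidableRel (G.comap σ).Adj] :
    IsLaplacianDecomposition (G.comap σ) (U.submatrix σ id) lam where
  orthogonal := by
    rw [mem_orthogonalGroup_iff, transpose_submatrix, ← submatrix_mul _ _ _ _ _
      Function.bijective_id, h.mul_transpose, submatrix_one_equiv]
  sorted := h.sorted
  decomposition := by
    rw [lapMatrix_comap_perm, h.decomposition]
    rfl

end IsLaplacianDecomposition

namespace OneLayerTransformer

variable {H dh : ℕ} {T : OneLayerTransformer n H dh} {u v : Fin n}

theorem PredictsEdge.edgeOutput_eq (hT : T.PredictsEdge u v G.maxDegree) (huv : u ≠ v)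
    (h : IsLaplacianDecomposition G U lam) {a b : Fin n} (hab : a ≠ b) :
    T.edgeOutput (laplacianTokens U lam) a b = G.adjMatrix ℝ a b := by
  classical
  obtain ⟨σ, rfl, rfl⟩ :=
    MulAction.is_two_pretransitive_iff.1 (Equiv.Perm.isMultiplyPretransitive (Fin n) 2) huv hab
  have hσ := hT (G.comap σ) (SimpleGraph.Iso.comap σ G).maxDegree_eq _ _ (h.comap_perm σ)
  rw [laplacianTokens_submatrix, edgeOutput_submatrix] at hσ
  simpa [SimpleGraph.adjMatrix_apply] using hσ

theorem PredictsEdge.one_le_mul_sqrt (hT : T.PredictsEdge u v G.maxDegree) (huv : u ≠ v)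
    (h : IsLaplacianDecomposition G U lam) (hbot : G ≠ ⊥) (htop : G ≠ ⊤) {LipMLP : ℝ≥0}
    (hLip : LipschitzWith LipMLP T.mlp) :
    1 ≤ LipMLP * ‖T.WV‖ * ‖T.Win‖ ^ 3 * (⨆ h, ‖T.WQK h‖) * √(2 * n * (1 + ∑ k, lam k ^ 2)) := by
  obtain ⟨a, b, hab⟩ := SimpleGraph.ne_bot_iff_exists_adj.1 hbot
  obtain ⟨c, d, hcd, hcd'⟩ := SimpleGraph.ne_top_iff_exists_not_adj.1 htop
  have hout := T.abs_edgeOutput_laplacianTokens_sub_le h.mul_transpose lam hLip a b c d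
  rwa [hT.edgeOutput_eq huv h hab.ne, hT.edgeOutput_eq huv h hcd, SimpleGraph.adjMatrix_apply,
    SimpleGraph.adjMatrix_apply, if_pos hab, if_neg hcd', sub_zero, abs_one] at hout

end OneLayerTransformer

theorem mul_sqrt_two_mul_mul_one_add_le {d s : ℝ} (hd : d ^ 2 ≤ s) (hn : 2 ≤ n) :
    d * √(2 * n * (1 + s)) ≤ 1 + n * s := by
  have hs : 0 ≤ s := (sq_nonneg d).trans hd
  have hn' : (2 : ℝ) ≤ n := by exact_mod_cast hn
  refine le_of_sq_le_sq ?_ (by positivity)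
  calc (d * √(2 * n * (1 + s))) ^ 2 = d ^ 2 * (2 * n * (1 + s)) := by
        rw [mul_pow, Real.sq_sqrt (by positivity)]
    _ ≤ s * (2 * n * (1 + s)) := by gcongr
    _ = 2 * (n * s) + 2 * (n * s ^ 2) := by ring
    _ ≤ 2 * (n * s) + n * (n * s ^ 2) := by gcongr
    _ ≤ (1 + n * s) ^ 2 := by linarith

theorem IsLaplacianDecomposition.maxDegree_mul_sqrt_le (h : IsLaplacianDecomposition G U lam)
    (hn : 2 ≤ n) :
    G.maxDegree * √(2 * n * (1 + ∑ k, lam k ^ 2)) ≤ ‖laplacianTokens U lam‖ ^ 2 := by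
  have : NeZero n := ⟨by omega⟩
  have hdeg : (G.maxDegree : ℝ) ^ 2 ≤ ∑ k, lam k ^ 2 :=
    h.sum_sq_eigenvalues ▸ sq_maxDegree_le_sum_sq_lapMatrix G
  exact (mul_sqrt_two_mul_mul_one_add_le hdeg hn).trans
    (one_add_mul_sum_sq_le_sq_norm_laplacianTokens lam h.mul_transpose)

end Decomposition

end Matrices

theorem theorem5_general {n H dh : ℕ} (hn : 3 ≤ n) (T : OneLayerTransformer n H dh)
    (LipMLP : ℝ≥0) (hLip : LipschitzWith LipMLP T.mlp)
    (u v : Fin n) (huv : u ≠ v) (dmax : ℕ) (hT : T.PredictsEdge u v dmax)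
    (G : SimpleGraph (Fin n)) [DecidableRel G.Adj] (hG : G.maxDegree = dmax)
    (U : Matrix (Fin n) (Fin n) ℝ) (lam : Fin n → ℝ) (hU : IsLaplacianDecomposition G U lam) :
    (dmax : ℝ) ≤
      LipMLP * ‖T.WV‖ * ‖T.Win‖ ^ 3 * T.logitEnergy (laplacianTokens U lam) := by
  subst hG
  have hκ := T.iSup_norm_WQK_nonneg
  rcases eq_or_ne G.maxDegree 0 with hd | hd
  · rw [hd, Nat.cast_zero]
    exact mul_nonneg (by positivity) (T.logitEnergy_nonneg _)
  obtain ⟨G', _, hle, hdeg, htop⟩ :=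
    exists_le_maxDegree_eq_ne_top G (by simpa only [Fintype.card_fin] using hn)
  have hbot : G' ≠ ⊥ := fun h => hd (hdeg ▸ SimpleGraph.maxDegree_eq_zero_iff.2 h)
  obtain ⟨U', lam', hU'⟩ := exists_isLaplacianDecomposition G'
  have hlam : ∑ k, lam' k ^ 2 ≤ ∑ k, lam k ^ 2 := by
    rw [hU'.sum_sq_eigenvalues, hU.sum_sq_eigenvalues]
    exact sum_sq_lapMatrix_mono hle
  set C := LipMLP * ‖T.WV‖ * ‖T.Win‖ ^ 3
  have hgap : 1 ≤ C * (⨆ h, ‖T.WQK h‖) * √(2 * n * (1 + ∑ k, lam k ^ 2)) :=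
    ((hdeg ▸ hT).one_le_mul_sqrt huv hU' hbot htop hLip).trans (by gcongr)
  calc (G.maxDegree : ℝ)
      ≤ G.maxDegree * (C * (⨆ h, ‖T.WQK h‖) * √(2 * n * (1 + ∑ k, lam k ^ 2))) :=
        le_mul_of_one_le_right (Nat.cast_nonneg _) hgap
    _ = C * ((⨆ h, ‖T.WQK h‖) * (G.maxDegree * √(2 * n * (1 + ∑ k, lam k ^ 2)))) := by ring
    _ ≤ C * T.logitEnergy (laplacianTokens U lam) := by
        unfold OneLayerTransformer.logitEnergy
        gcongr
        exact hU.maxDegree_mul_sqrt_le (by omega)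

theorem theorem5 {n H dh : ℕ} (hn : 3 ≤ n) (T : OneLayerTransformer n H dh)
    (hWin : ‖T.Win‖ ≤ 1)
    (LipMLP : ℝ≥0) (hLip : LipschitzWith LipMLP T.mlp)
    (u v : Fin n) (huv : u ≠ v) (dmax : ℕ) (hT : T.PredictsEdge u v dmax)
    (G : SimpleGraph (Fin n)) [DecidableRel G.Adj] (hG : G.maxDegree = dmax)
    (U : Matrix (Fin n) (Fin n) ℝ) (lam : Fin n → ℝ) (hU : IsLaplacianDecomposition G U lam) :
    (dmax : ℝ) ≤
      (LipMLP : ℝ) * ‖T.WV‖ * (1 + T.logitEnergy (laplacianTokens U lam)) := by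
  exact (theorem5_general hn T LipMLP hLip u v huv dmax hT G hG U lam hU).trans <|
    mul_le_mul (mul_le_of_le_one_right (by positivity) (pow_le_one₀ (norm_nonneg _) hWin))
      (le_add_of_nonneg_left zero_le_one) (T.logitEnergy_nonneg _) (by positivity)
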